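/- Let $(a(n))_{n\ge 0}$ be Stern's diatomic sequence, defined by $a(0)=0$, $a(1)=1$, $a(2n)=a(n)$ and $a(2n+1)=a(n)+a(n+1)$ for $n \ge 0$, and let $s(n)=a(n+1)$ for $n\ge 0$. A record-setter of $s$ is an index $v\ge 0$ such that $s(i)<s(v)$ for all $0\le i<v$. Identify a positive integer with its binary representation (most significant digit first, no leading zeros), and for a string $x$ let $x^k$ denote $x$ repeated $k$ times. **Theorem.** Let $n\ge 5$. The record-setters of $s$ whose binary representation has length $2n+2$ are exactly the integers with the following binary representations: $$\begin{cases} 1000\,(10)^{n-1},\\ 100\,(10)^{i+1}\,0\,(10)^{n-i-2}, & \text{for } 0\le i\le n-2,\\ (10)^i\,0\,(10)^{n-i}\,0, & \text{for } 1<i\le \lceil n/2\rceil,\\ (10)^{n+1}. \end{cases}$$ -/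

import Mathlib

namespace SternRecord

/-- Stern's diatomic sequence: `a 0 = 0`, `a 1 = 1`, `a (2 n) = a n`, `a (2 n + 1) = a n + a (n + 1)`. -/
def stern : ℕ → ℕ
  | 0 => 0
  | 1 => 1
  | n + 2 =>
    if (n + 2) % 2 = 0 then stern ((n + 2) / 2)
    else stern ((n + 2) / 2) + stern ((n + 2) / 2 + 1)
decreasing_by all_goals omega

theorem stern_zero : stern 0 = 0 := by rw [stern]

theorem stern_one : stern 1 = 1 := by rw [stern]

theorem stern_two_mul (n : ℕ) : stern (2 * n) = stern n := by
  rcases n with _ | n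
  · rfl
  · rw [show 2 * (n + 1) = 2 * n + 2 by ring, stern, if_pos (by omega)]
    congr 1
    omega

theorem stern_two_mul_add_one (n : ℕ) : stern (2 * n + 1) = stern n + stern (n + 1) := by
  rcases n with _ | n
  · simp [stern_zero]
  · rw [show 2 * (n + 1) + 1 = (2 * n + 1) + 2 by ring, stern, if_neg (by omega)]
    congr 2 <;> omega

/-- The Stern sequence shifted by one, `s n = a (n + 1)`. -/
def shiftedStern (n : ℕ) : ℕ := stern (n + 1)

/-- The record-setters of a sequence `s`: the indices `v` with `s i < s v` for all `i < v`. -/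
def recordSetters (s : ℕ → ℕ) : Set ℕ := {v | ∀ i < v, s i < s v}

/-- The binary representation of `v`, most significant digit first, without leading zeros. -/
def binaryString (v : ℕ) : List ℕ := (Nat.digits 2 v).reverse

/-- `strPow x k` is the string `x` repeated `k` times. -/
def strPow (x : List ℕ) (k : ℕ) : List ℕ := (List.replicate k x).flatten

end SternRecord

namespace SternRecord

open Nat (fib)
open Real (goldenRatio)

/-! Appending a binary digit acts linearly on the pair (`stern v`, `stern (v + 1)`), and appending
`10` acts by a matrix whose powers have Fibonacci entries. Note that `append10 j 0` is the string
(10)^j.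

The claimed record-setters form one chain: (10)^n 0, then 100(10)^m 0(10)^(n-1-m) with m increasing,
then (10)^i 0(10)^(n-i)0 with i increasing to ⌈n/2⌉, then (10)^(n+1). Only the first has length less
than 2n+2. The two families share the string m = n-1, i = 1. Every link c, c' is a `RecordGap`:
s(c') > s(c), while s ≤ s(c) below c'. Hence each c' is a record-setter and none lies strictly
between c and c'.

To bound s below c', sort the indices by where their digits leave those of c'. The indices with
prefix v0, where c' has v10, form a dyadic block whose values are bounded by a Fibonacci combination
of `stern v` and `stern (v + 1)` (`stern_le_fib`). For branches before the inserted 0 these bounds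
are values `lucasBranch` or `fibBranch` of earlier chain type, monotone along the chain
(`lucasBranch_lt`, `fibBranch_lt`). Branches after it are handled by `even_branch_le` and
`odd_branch_le`. -/

/-- The number whose binary representation is that of `v` followed by `j` copies of `10`. -/
def append10 : ℕ → ℕ → ℕ
  | 0, v => v
  | j + 1, v => 4 * append10 j v + 2

/-! ### Stern values after appending `10` -/

theorem stern_append10_succ (j v : ℕ) :
    stern (append10 (j + 1) v) = stern (append10 j v) + stern (append10 j v + 1) := by
  rw [append10, show 4 * append10 j v + 2 = 2 * (2 * append10 j v + 1) by ring,
    stern_two_mul, stern_two_mul_add_one]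

theorem stern_append10_succ_add_one (j v : ℕ) :
    stern (append10 (j + 1) v + 1) = stern (append10 j v) + 2 * stern (append10 j v + 1) := by
  rw [append10, show 4 * append10 j v + 2 + 1 = 2 * (2 * append10 j v + 1) + 1 by ring,
    stern_two_mul_add_one, stern_two_mul_add_one,
    show 2 * append10 j v + 1 + 1 = 2 * (append10 j v + 1) by ring, stern_two_mul]
  ring

/-- Powers of the matrix with rows (1, 1) and (1, 2). The difference of Fibonacci numbers is
F(2j-1), written so as to make sense at j = 0; real casts avoid truncated subtraction. -/
theorem stern_append10 (j v : ℕ) :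
    (stern (append10 j v) : ℝ) =
        (fib (2 * j + 1) - fib (2 * j)) * stern v + fib (2 * j) * stern (v + 1) ∧
      (stern (append10 j v + 1) : ℝ) = fib (2 * j) * stern v + fib (2 * j + 1) * stern (v + 1) := by
  induction j with
  | zero => simp [append10]
  | succ j ih =>
    rw [stern_append10_succ, stern_append10_succ_add_one, show 2 * (j + 1) = 2 * j + 2 by ring,
      Nat.fib_add_two (n := 2 * j + 1), Nat.fib_add_two (n := 2 * j)]
    push_cast
    rw [ih.1, ih.2]
    constructor <;> ring

theorem stern_append10_zero (j : ℕ) :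
    stern (append10 j 0) = fib (2 * j) ∧ stern (append10 j 0 + 1) = fib (2 * j + 1) := by
  have h := stern_append10 j 0
  simp only [stern_zero, zero_add, stern_one, Nat.cast_zero, Nat.cast_one, mul_zero, mul_one] at h
  exact_mod_cast h

theorem append10_mul_lt (j v k : ℕ) : append10 j v * 2 ^ k < (v + 1) * 2 ^ (2 * j + k) := by
  induction j generalizing k with
  | zero => simp [append10, add_mul]
  | succ j ih =>
    have h := ih (k + 2)
    rw [append10, show 2 * (j + 1) + k = 2 * j + (k + 2) by ring]
    have h2 : append10 j v * 2 ^ (k + 2) = 4 * append10 j v * 2 ^ k := by ring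
    have h3 : (v + 1) * 2 ^ (2 * j + (k + 2)) = 4 * ((v + 1) * 2 ^ (2 * j)) * 2 ^ k := by ring
    rw [h2, h3] at h
    rw [h3]
    have h4 := lt_of_mul_lt_mul_right h (Nat.zero_le _)
    apply mul_lt_mul_of_pos_right _ (by positivity)
    omega

/-! ### Branch bounds along a path of digits -/

/-- Growth of the Stern sequence below a node of the binary tree. -/
theorem stern_le_fib (k : ℕ) : ∀ v r p q : ℕ, r ≤ 2 ^ k → p ≤ q →
    (stern v ≤ p ∧ stern (v + 1) ≤ q ∨ stern v ≤ q ∧ stern (v + 1) ≤ p) →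
    stern (v * 2 ^ k + r) ≤ fib k * p + fib (k + 1) * q := by
  induction k with
  | zero =>
    intro v r p q hr hpq h
    have hr' : r = 0 ∨ r = 1 := by simp at hr; omega
    rcases hr' with rfl | rfl <;> simp <;> omega
  | succ k ih =>
    intro v r p q hr hpq h
    -- Either half of the interval keeps one endpoint, at most q, and gains the midpoint, at most p
    -- + q. So (p, q) becomes (q, p + q).
    have key : fib (k + 1) * p + fib (k + 2) * q = fib k * q + fib (k + 1) * (p + q) := by
      rw [Nat.fib_add_two]; ring
    rw [key]
    have h0 := stern_two_mul v
    have h1 := stern_two_mul_add_one v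
    have h2 := stern_two_mul (v + 1)
    rw [pow_succ] at hr
    rcases le_total r (2 ^ k) with hk | hk
    · rw [show v * 2 ^ (k + 1) + r = 2 * v * 2 ^ k + r by ring]
      exact ih _ _ _ _ hk (by omega) (by omega)
    · obtain ⟨r, rfl⟩ := Nat.exists_eq_add_of_le hk
      rw [show v * 2 ^ (k + 1) + (2 ^ k + r) = (2 * v + 1) * 2 ^ k + r by ring]
      refine ih _ _ _ _ (by omega) (by omega) ?_
      rw [show 2 * v + 1 + 1 = 2 * (v + 1) by ring]
      omega

/-- `M` bounds the shifted Stern sequence strictly below `t`. -/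
def BoundedBelow (M : ℝ) (t : ℕ) : Prop := ∀ i < t, (shiftedStern i : ℝ) ≤ M

theorem boundedBelow_two_pow {M : ℝ} (k : ℕ) (h : (fib (k + 1) : ℝ) ≤ M) :
    BoundedBelow M (2 ^ k) := by
  intro i hi
  refine le_trans ?_ h
  have := stern_le_fib k 0 (i + 1) 0 1 hi (by norm_num) (Or.inl (by simp [stern_zero, stern_one]))
  simp only [zero_mul, zero_add, mul_zero, mul_one] at this
  exact_mod_cast this

/-- The indices gained are exactly those with prefix v0 and k + 1 further digits, and `hM` is the
`stern_le_fib` bound for that block. -/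
theorem BoundedBelow.append {M : ℝ} {v k : ℕ} (h : BoundedBelow M (v * 2 ^ (k + 2)))
    (hM : (fib (k + 3) * stern v + fib (k + 2) * stern (v + 1) : ℝ) ≤ M) :
    BoundedBelow M ((4 * v + 2) * 2 ^ k) := by
  intro i hi
  rcases lt_or_ge i (v * 2 ^ (k + 2)) with hlt | hge
  · exact h i hlt
  · obtain ⟨r, rfl⟩ := Nat.exists_eq_add_of_le hge
    have hr : r + 1 ≤ 2 ^ (k + 1) := by
      have e : (4 * v + 2) * 2 ^ k = v * 2 ^ (k + 2) + 2 ^ (k + 1) := by ring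
      omega
    have := stern_le_fib (k + 1) (2 * v) (r + 1) (stern v) (stern v + stern (v + 1)) hr
      (Nat.le_add_right _ _)
      (Or.inl ⟨(stern_two_mul v).le, (stern_two_mul_add_one v).le⟩)
    refine le_trans ?_ hM
    rw [shiftedStern, show v * 2 ^ (k + 2) + r + 1 = 2 * v * 2 ^ (k + 1) + (r + 1) by ring,
      Nat.fib_add_two (n := k + 1)]
    push_cast
    have h' : (stern (2 * v * 2 ^ (k + 1) + (r + 1)) : ℝ) ≤
        fib (k + 1) * stern v + fib (k + 1 + 1) * (stern v + stern (v + 1)) := by exact_mod_cast this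
    linarith

theorem BoundedBelow.append10 {M : ℝ} {v : ℕ} (J : ℕ) : ∀ k : ℕ,
    BoundedBelow M (v * 2 ^ (2 * J + k)) →
    (∀ j < J, (fib (2 * (J - j) + k + 1) * stern (append10 j v) +
      fib (2 * (J - j) + k) * stern (append10 j v + 1) : ℝ) ≤ M) →
    BoundedBelow M (append10 J v * 2 ^ k) := by
  induction J with
  | zero =>
    intro k h _
    simpa [SternRecord.append10] using h
  | succ J ih =>
    intro k h hM
    refine BoundedBelow.append (ih (k + 2) ?_ ?_) ?_
    · rwa [show 2 * J + (k + 2) = 2 * (J + 1) + k by ring]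
    · intro j hj
      have := hM j (by omega)
      rwa [show 2 * (J + 1 - j) + k = 2 * (J - j) + (k + 2) by omega] at this
    · have := hM J (by omega)
      rwa [show 2 * (J + 1 - J) + k = k + 2 by omega] at this

/-! ### Fibonacci and Lucas ratios against the golden ratio -/

theorem goldenRatio_mul_fib_le (k : ℕ) :
    goldenRatio * fib (2 * k) ≤ fib (2 * k + 1) ∧
      (fib (2 * k + 2) : ℝ) < goldenRatio * fib (2 * k + 1) := by
  have hsq := Real.goldenRatio_sq
  have h1 := Real.one_lt_goldenRatio
  have step : ∀ k : ℕ, goldenRatio * fib (2 * k) ≤ fib (2 * k + 1) →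
      (fib (2 * k + 2) : ℝ) ≤ goldenRatio * fib (2 * k + 1) := by
    intro k h
    rw [Nat.fib_add_two]
    push_cast
    nlinarith
  have hle : goldenRatio * fib (2 * k) ≤ fib (2 * k + 1) := by
    induction k with
    | zero => simp
    | succ k ih =>
      have := step k ih
      rw [show 2 * (k + 1) = 2 * k + 2 by ring, Nat.fib_add_two (n := 2 * k + 1)]
      push_cast
      nlinarith
  refine ⟨hle, lt_of_le_of_ne (step k hle) fun h => ?_⟩
  have hirr := Real.goldenRatio_irrational
  have hpos : (0 : ℝ) < fib (2 * k + 1) := by exact_mod_cast Nat.fib_pos.2 (by omega)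
  refine hirr ⟨(fib (2 * k + 2) : ℚ) / fib (2 * k + 1), ?_⟩
  push_cast
  rw [h, mul_div_cancel_right₀ _ hpos.ne']

theorem eight_fifths_lt_goldenRatio : 8 / 5 < goldenRatio := by
  have := Real.goldenRatio_sq
  have := Real.one_lt_goldenRatio
  nlinarith

theorem stern_four : stern 4 = 1 := by
  rw [show 4 = 2 * (2 * 1) by norm_num, stern_two_mul, stern_two_mul, stern_one]

theorem stern_five : stern 5 = 3 := by
  rw [show 5 = 2 * (2 * 1) + 1 by norm_num, stern_two_mul_add_one, stern_two_mul,
    show 2 * 1 + 1 = 2 * 1 + 1 by rfl, stern_two_mul_add_one, show 1 + 1 = 2 * 1 by norm_num,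
    stern_two_mul, stern_one]

/-- The values of the sequence at `append10 m 4` and its successor (the Lucas numbers). -/
theorem lucas_ratio (m : ℕ) :
    (stern (append10 m 4 + 1) : ℝ) ≤ 3 * stern (append10 m 4) ∧
      goldenRatio * stern (append10 m 4) < stern (append10 m 4 + 1) ∧
      0 < stern (append10 m 4) := by
  have hsq := Real.goldenRatio_sq
  have h1 := Real.one_lt_goldenRatio
  have h2 := Real.goldenRatio_lt_two
  have e4 := stern_four
  have e5 := stern_five
  induction m with
  | zero =>
    simp only [append10, e4, e5]
    norm_num
    linarith
  | succ m ih =>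
    rw [stern_append10_succ, stern_append10_succ_add_one]
    push_cast
    obtain ⟨ih1, ih2, ih3⟩ := ih
    refine ⟨by linarith, by nlinarith, by omega⟩

theorem fib_two_mul_add_add_one (i m : ℕ) :
    (fib (2 * i + m + 1) : ℝ) = fib (2 * i) * fib m + fib (2 * i + 1) * fib (m + 1) := by
  exact_mod_cast Nat.fib_add (2 * i) m

theorem fib_add_two_cast (m : ℕ) : (fib (m + 2) : ℝ) = fib m + fib (m + 1) := by
  exact_mod_cast Nat.fib_add_two

theorem fib_two_mul_lt (k : ℕ) : (fib (2 * k) : ℝ) < fib (2 * k + 1) := by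
  have h := (goldenRatio_mul_fib_le k).1
  have h0 : (0 : ℝ) ≤ fib (2 * k) := Nat.cast_nonneg _
  have hpos : (0 : ℝ) < fib (2 * k + 1) := by exact_mod_cast Nat.fib_pos.2 (by omega)
  have h1 := eight_fifths_lt_goldenRatio
  nlinarith

/-! ### Comparison of branch maxima -/

/-- Bound for the branches below `append10 J v`, at an even distance from the leaves. -/
theorem even_branch_le (v p j : ℕ) (hv : 2 * stern v ≤ stern (v + 1)) :
    5 * (fib (2 * p + 1) * stern (append10 j v) + fib (2 * p) * stern (append10 j v + 1) : ℝ) ≤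
      stern v * (4 * fib (2 * (p + j) + 1) - 2 * fib (2 * (p + j))) +
        stern (v + 1) * (2 * fib (2 * (p + j) + 1) + 4 * fib (2 * (p + j))) := by
  -- With N = p + j and Lucas numbers L, the right side is 2·`stern v`·L(2N) + 2·`stern (v +
  -- 1)`·L(2N+1). It exceeds the left by `stern v`·L(2(j-p)-1) + `stern (v + 1)`·L(2(j-p)), which
  -- `hv` makes nonnegative.
  obtain ⟨hX, hY⟩ := stern_append10 j v
  rw [hX, hY]
  have h1 : (fib (2 * (p + j) + 1) : ℝ) =
      fib (2 * p) * fib (2 * j) + fib (2 * p + 1) * fib (2 * j + 1) := by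
    rw [← fib_two_mul_add_add_one]; congr 2; ring
  have h2 : (fib (2 * (p + j)) : ℝ) =
      fib (2 * p) * (fib (2 * j + 1) - fib (2 * j)) + fib (2 * p + 1) * fib (2 * j) := by
    have := fib_two_mul_add_add_one p (2 * j + 1)
    rw [show 2 * p + (2 * j + 1) + 1 = 2 * (p + j) + 2 by ring, fib_add_two_cast, h1,
      fib_add_two_cast (2 * j)] at this
    linarith
  rw [h1, h2]
  have hA := (goldenRatio_mul_fib_le p).1
  have hE := (goldenRatio_mul_fib_le j).1
  have hA0 : (0 : ℝ) ≤ fib (2 * p) := Nat.cast_nonneg _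
  have hE0 : (0 : ℝ) ≤ fib (2 * j) := Nat.cast_nonneg _
  have hx0 : (0 : ℝ) ≤ stern v := Nat.cast_nonneg _
  have hv' : (2 * stern v : ℝ) ≤ stern (v + 1) := by exact_mod_cast hv
  have hsq := Real.goldenRatio_sq
  have hφ := eight_fifths_lt_goldenRatio
  generalize (fib (2 * p) : ℝ) = A at *
  generalize (fib (2 * j) : ℝ) = E at *
  -- Measuring odd Fibonacci numbers by their excess over φ times the preceding one cancels the A·E
  -- terms, since φ² = φ + 1; the other coefficients are nonnegative.
  obtain ⟨ε, hε⟩ : ∃ ε, (fib (2 * p + 1) : ℝ) = goldenRatio * A + ε :=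
    ⟨_, (add_sub_cancel _ _).symm⟩
  obtain ⟨δ, hδ⟩ : ∃ δ, (fib (2 * j + 1) : ℝ) = goldenRatio * E + δ :=
    ⟨_, (add_sub_cancel _ _).symm⟩
  obtain ⟨z, hz⟩ : ∃ z, (stern (v + 1) : ℝ) = 2 * stern v + z :=
    ⟨_, (add_sub_cancel _ _).symm⟩
  rw [hε] at hA
  rw [hδ] at hE
  rw [hz] at hv'
  rw [hε, hδ, hz]
  have hε0 : 0 ≤ ε := by linarith
  have hδ0 : 0 ≤ δ := by linarith
  have hz0 : 0 ≤ z := by linarith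
  generalize (stern v : ℝ) = x at *
  generalize goldenRatio = φ at *
  have key : 0 ≤ x * ((3 * φ - 4) * (A * δ) + (3 * φ + 1) * (ε * E) + 3 * (ε * δ)) +
      z * ((2 * φ - 1) * (A * δ) + (2 * φ - 1) * (ε * E) + 2 * (ε * δ)) := by
    have := mul_nonneg hA0 hδ0
    have := mul_nonneg hε0 hE0
    have := mul_nonneg hε0 hδ0
    have c1 : 0 ≤ 3 * φ - 4 := by linarith
    have c2 : 0 ≤ 2 * φ - 1 := by linarith
    have c3 : 0 ≤ 3 * φ + 1 := by linarith
    positivity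
  linear_combination key - (3 * x + 2 * z) * A * E * hsq

/-- The maximum of the sequence below the branch leaving `append10 j 4`. -/
def lucasBranch (p j : ℕ) : ℕ :=
  fib (2 * p + 2) * stern (append10 j 4) + fib (2 * p + 1) * stern (append10 j 4 + 1)

/-- With r, s the Stern values at `append10 j 4` and its successor, the difference is F(2p+1)s -
F(2p+2)r, positive because F(2p+2)/F(2p+1) < φ < s/r. -/
theorem lucasBranch_lt (p j : ℕ) : lucasBranch (p + 1) j < lucasBranch p (j + 1) := by
  have h : (lucasBranch (p + 1) j : ℝ) < lucasBranch p (j + 1) := by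
    rw [lucasBranch, lucasBranch, stern_append10_succ, stern_append10_succ_add_one,
      show 2 * (p + 1) + 2 = 2 * p + 2 + 2 by ring, show 2 * (p + 1) + 1 = 2 * p + 1 + 2 by ring]
    push_cast
    rw [fib_add_two_cast (2 * p + 2), fib_add_two_cast (2 * p + 1)]
    obtain ⟨-, h1, h2⟩ := lucas_ratio j
    have h3 := (goldenRatio_mul_fib_le p).2
    have hr : (0 : ℝ) < stern (append10 j 4) := by exact_mod_cast h2
    have ha : (0 : ℝ) ≤ fib (2 * p + 1) := Nat.cast_nonneg _
    generalize (stern (append10 j 4) : ℝ) = r at *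
    generalize (stern (append10 j 4 + 1) : ℝ) = s at *
    have e1 := mul_lt_mul_of_pos_right h3 hr
    have e2 := mul_le_mul_of_nonneg_left h1.le ha
    ring_nf at e1 e2 ⊢
    linarith
  exact_mod_cast h

theorem lucasBranch_mono (p j d : ℕ) : lucasBranch (p + d) j ≤ lucasBranch p (j + d) := by
  induction d generalizing j with
  | zero => rfl
  | succ d ih =>
    have := ih (j + 1)
    rw [show j + 1 + d = j + (d + 1) by ring] at this
    exact (lucasBranch_lt (p + d) j).le.trans this

theorem fib_lt_lucasBranch_zero (p : ℕ) : fib (2 * p + 4) < lucasBranch p 0 := by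
  rw [lucasBranch, append10, stern_four, stern_five, Nat.fib_add_two (n := 2 * p + 2),
    Nat.fib_add_two (n := 2 * p + 1), Nat.fib_add_two (n := 2 * p)]
  have : fib (2 * p) < fib (2 * p + 1) := by exact_mod_cast fib_two_mul_lt p
  omega

/-- The maximum of the sequence below the branch leaving `append10 i 0`. -/
def fibBranch (p i : ℕ) : ℕ := fib (2 * i) * fib (2 * p + 1) + fib (2 * i + 1) * fib (2 * p)

theorem fibBranch_comm (p i : ℕ) : fibBranch p i = fibBranch i p := by
  rw [fibBranch, fibBranch]; ring

/-- The difference of the two products is a determinant unchanged by i ↦ i + 1, equal to F(2d) at i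
= 0. -/
theorem fib_even_mul_odd_lt (d i : ℕ) (hd : 0 < d) :
    fib (2 * i) * fib (2 * (i + d) + 1) < fib (2 * i + 1) * fib (2 * (i + d)) := by
  induction i with
  | zero => simpa using hd
  | succ i ih =>
    rw [show 2 * (i + 1) = 2 * i + 2 by ring, show 2 * (i + 1 + d) = 2 * (i + d) + 2 by ring,
      Nat.fib_add_two (n := 2 * i + 1), Nat.fib_add_two (n := 2 * i),
      Nat.fib_add_two (n := 2 * (i + d) + 1), Nat.fib_add_two (n := 2 * (i + d))]
    linarith

theorem fibBranch_lt {p i : ℕ} (h : i < p) : fibBranch (p + 1) i < fibBranch p (i + 1) := by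
  obtain ⟨d, rfl⟩ := Nat.exists_eq_add_of_le h.le
  have := fib_even_mul_odd_lt d i (by omega)
  rw [fibBranch, fibBranch, show 2 * (i + 1) = 2 * i + 2 by ring,
    show 2 * (i + d + 1) = 2 * (i + d) + 2 by ring,
    Nat.fib_add_two (n := 2 * i + 1), Nat.fib_add_two (n := 2 * i),
    Nat.fib_add_two (n := 2 * (i + d) + 1), Nat.fib_add_two (n := 2 * (i + d))]
  linarith

theorem fibBranch_mono {p j d : ℕ} (h : j + d ≤ p) :
    fibBranch (p + d) j ≤ fibBranch p (j + d) := by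
  induction d generalizing j with
  | zero => rfl
  | succ d ih =>
    have := ih (j := j + 1) (by omega)
    rw [show j + 1 + d = j + (d + 1) by ring] at this
    exact (fibBranch_lt (show j < p + d by omega)).le.trans this

/-- Bound for the branches below `append10 J (2 * append10 i 0)` at an odd distance from the
leaves. -/
theorem odd_branch_le (i r j : ℕ) :
    (fib (2 * r + 4) * stern (append10 j (2 * append10 i 0)) +
      fib (2 * r + 3) * stern (append10 j (2 * append10 i 0) + 1) : ℝ) ≤
      fibBranch (r + 1 + j + i) 1 := by
  -- With N = r + 1 + j + i, the target is the Lucas number F(2N+1) + 2F(2N).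
  obtain ⟨hX, hY⟩ := stern_append10 j (2 * append10 i 0)
  rw [hX, hY, stern_two_mul, stern_two_mul_add_one, (stern_append10_zero i).1,
    (stern_append10_zero i).2, fibBranch]
  have hM1 : (fib (2 * (r + 1 + j + i) + 1) : ℝ) =
      fib (2 * i) * fib (2 * (r + 1) + 2 * j) + fib (2 * i + 1) * fib (2 * (r + 1) + 2 * j + 1) := by
    rw [← fib_two_mul_add_add_one]; congr 2; ring
  have hM0 : (fib (2 * (r + 1 + j + i)) : ℝ) =
      fib (2 * i) * fib (2 * r + 2 * j + 1) + fib (2 * i + 1) * fib (2 * r + 2 * j + 2) := by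
    rw [← fib_two_mul_add_add_one]; congr 2; ring
  have a1 : (fib (2 * r + 2 * j + 1) : ℝ) =
      fib (2 * r) * fib (2 * j) + fib (2 * r + 1) * fib (2 * j + 1) :=
    fib_two_mul_add_add_one r (2 * j)
  have a2 : (fib (2 * r + 2 * j + 2) : ℝ) =
      fib (2 * r) * fib (2 * j + 1) + fib (2 * r + 1) * (fib (2 * j) + fib (2 * j + 1)) := by
    rw [← fib_add_two_cast]
    exact fib_two_mul_add_add_one r (2 * j + 1)
  have a3 : (fib (2 * r + 2 * j + 2 + 1) : ℝ) =
      fib (2 * r + 2 * j + 1) + fib (2 * r + 2 * j + 2) := fib_add_two_cast _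
  rw [show 2 * (r + 1) + 2 * j = 2 * r + 2 * j + 2 by ring, a3] at hM1
  push_cast
  rw [hM1, hM0, a2, a1, fib_add_two_cast (2 * r + 2), fib_add_two_cast (2 * r + 1),
    fib_add_two_cast (2 * r)]
  have hφ := eight_fifths_lt_goldenRatio
  have hpq := (goldenRatio_mul_fib_le i).1
  have hp0 : (0 : ℝ) ≤ fib (2 * i) := Nat.cast_nonneg _
  have hq : (3 * fib (2 * i) : ℝ) ≤ 2 * fib (2 * i + 1) := by nlinarith
  have hED := fib_two_mul_lt j
  have hE0 : (0 : ℝ) ≤ fib (2 * j) := Nat.cast_nonneg _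
  have hR0 : (0 : ℝ) ≤ fib (2 * r) := Nat.cast_nonneg _
  have hP0 : (0 : ℝ) ≤ fib (2 * r + 1) := Nat.cast_nonneg _
  simp only [Nat.fib_two, Nat.cast_one, show fib (2 + 1) = 2 from rfl,
    Nat.cast_ofNat]
  generalize (fib (2 * i) : ℝ) = p at *
  generalize (fib (2 * r) : ℝ) = R at *
  generalize (fib (2 * r + 1) : ℝ) = P at *
  generalize (fib (2 * j) : ℝ) = E at *
  obtain ⟨D, hD⟩ : ∃ D, (fib (2 * j + 1) : ℝ) = E + D :=
    ⟨_, (add_sub_cancel _ _).symm⟩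
  obtain ⟨z, hz⟩ : ∃ z, (fib (2 * i + 1) : ℝ) = 3 / 2 * p + z :=
    ⟨_, (add_sub_cancel _ _).symm⟩
  rw [hD] at hED
  rw [hz] at hq
  rw [hD, hz]
  have hD0 : 0 ≤ D := by linarith
  have hz0 : 0 ≤ z := by linarith
  have key : 0 ≤ z * (P * E + 2 * (P + R) * D + (P + R) * E) +
      p * ((P + R) * D + 1 / 2 * R * E) := by positivity
  linear_combination key

/-! ### Record gaps: the links of the chain -/

/-- `c'` is the first index at which the shifted Stern sequence exceeds its value at `c`, which is
its maximum below `c'`. -/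
def RecordGap (c c' : ℕ) : Prop :=
  shiftedStern c < shiftedStern c' ∧ BoundedBelow (shiftedStern c) c'

theorem RecordGap.mem_recordSetters {c c' : ℕ} (h : RecordGap c c') :
    c' ∈ recordSetters shiftedStern := by
  intro i hi
  have : shiftedStern i ≤ shiftedStern c := by exact_mod_cast h.2 i hi
  exact this.trans_lt h.1

theorem RecordGap.le_of_lt {c c' v : ℕ} (h : RecordGap c c')
    (hv : v ∈ recordSetters shiftedStern) (hlt : v < c') : v ≤ c := by
  by_contra! hc
  have : shiftedStern v ≤ shiftedStern c := by exact_mod_cast h.2 v hlt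
  exact absurd (hv c hc) (by omega)

theorem le_or_eq_of_recordGap {f : ℕ → ℕ} {a b v : ℕ} (hab : a ≤ b)
    (hf : ∀ k, a ≤ k → k < b → RecordGap (f k) (f (k + 1)))
    (hv : v ∈ recordSetters shiftedStern) (hle : v ≤ f b) :
    v ≤ f a ∨ ∃ k, a < k ∧ k ≤ b ∧ v = f k := by
  induction b, hab using Nat.le_induction with
  | base => exact Or.inl hle
  | succ b hab ih =>
    rcases hle.eq_or_lt with rfl | hlt
    · exact Or.inr ⟨b + 1, by omega, le_rfl, rfl⟩
    · rcases ih (fun k h1 h2 => hf k h1 (by omega))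
        ((hf b hab (by omega)).le_of_lt hv hlt) with h | ⟨k, h1, h2, h3⟩
      · exact Or.inl h
      · exact Or.inr ⟨k, h1, by omega, h3⟩

theorem shiftedStern_append10_zero (j : ℕ) : shiftedStern (append10 j 0) = fib (2 * j + 1) :=
  (stern_append10_zero j).2

theorem shiftedStern_append10_two_mul (J w : ℕ) : shiftedStern (append10 J (2 * w)) =
    fib (2 * J + 2) * stern w + fib (2 * J + 1) * stern (w + 1) := by
  have h := (stern_append10 J (2 * w)).2
  rw [stern_two_mul, stern_two_mul_add_one] at h
  rw [shiftedStern, Nat.fib_add_two]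
  have h' : stern (append10 J (2 * w) + 1) =
      fib (2 * J) * stern w + fib (2 * J + 1) * (stern w + stern (w + 1)) := by exact_mod_cast h
  rw [h']
  ring

theorem shiftedStern_append10_four (J m : ℕ) :
    shiftedStern (append10 J (2 * append10 m 4)) = lucasBranch J m :=
  shiftedStern_append10_two_mul _ _

theorem shiftedStern_two_mul_append10 (J i : ℕ) :
    shiftedStern (2 * append10 J (2 * append10 i 0)) = fibBranch (J + 1) i := by
  have h := shiftedStern_append10_two_mul (J + 1) (append10 i 0)
  have h2 := shiftedStern_append10_two_mul J (append10 i 0)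
  have h3 := stern_append10_succ_add_one J (2 * append10 i 0)
  have h4 := stern_two_mul_add_one (append10 J (2 * append10 i 0))
  rw [(stern_append10_zero i).1, (stern_append10_zero i).2] at h h2
  rw [shiftedStern, show 2 * (J + 1) + 2 = 2 * J + 2 + 2 by ring,
    show 2 * (J + 1) + 1 = 2 * J + 1 + 2 by ring, Nat.fib_add_two (n := 2 * J + 2),
    Nat.fib_add_two (n := 2 * J + 1)] at h
  rw [shiftedStern] at h2 ⊢
  rw [fibBranch, show 2 * (J + 1) + 1 = 2 * J + 1 + 2 by ring,
    show 2 * (J + 1) = 2 * J + 2 by ring, Nat.fib_add_two (n := 2 * J + 1), h4]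
  linarith

/-- The value F(2J+4) at (10)^(J+1)0 is already the maximum below 2^(2J+3); only the branches after
1000 remain. -/
theorem recordGap_first (J : ℕ) :
    RecordGap (2 * append10 (J + 1) 0) (append10 J (2 * append10 0 4)) := by
  have hs : shiftedStern (2 * append10 (J + 1) 0) = fib (2 * J + 4) := by
    rw [shiftedStern, stern_two_mul_add_one, (stern_append10_zero _).1, (stern_append10_zero _).2,
      show 2 * J + 4 = 2 * (J + 1) + 2 by ring, Nat.fib_add_two]
  refine ⟨?_, ?_⟩
  · rw [hs, shiftedStern_append10_four]
    exact fib_lt_lucasBranch_zero J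
  · rw [hs, append10, show (2 * 4) = 8 by norm_num]
    have h8 : stern 8 = 1 := by rw [show 8 = 2 * 4 by norm_num, stern_two_mul, stern_four]
    have h9 : stern (8 + 1) = 4 := by
      rw [show 8 + 1 = 2 * 4 + 1 by norm_num, stern_two_mul_add_one, stern_four, stern_five]
    have := BoundedBelow.append10 (M := fib (2 * J + 4)) (v := 8) J 0 ?_ ?_
    · simpa using this
    · rw [show 8 * 2 ^ (2 * J + 0) = 2 ^ (2 * J + 3) by ring]
      exact boundedBelow_two_pow _ le_rfl
    · intro j hj
      have h := even_branch_le 8 (J - j) j (by rw [h8, h9]; norm_num)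
      rw [show J - j + j = J by omega, h8, h9] at h
      have e := fib_add_two_cast (2 * J + 2)
      rw [fib_add_two_cast (2 * J + 1), fib_add_two_cast (2 * J)] at e
      have h2 := (goldenRatio_mul_fib_le J).1
      have h3 := eight_fifths_lt_goldenRatio
      have h4 : (0 : ℝ) ≤ fib (2 * J) := Nat.cast_nonneg _
      have h5 : (8 / 5 * fib (2 * J) : ℝ) ≤ goldenRatio * fib (2 * J) :=
        mul_le_mul_of_nonneg_right h3.le h4
      rw [add_zero]
      push_cast at h
      linarith

theorem recordGap_lucas (J m : ℕ) : RecordGap (append10 (J + 1) (2 * append10 m 4))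
    (append10 J (2 * append10 (m + 1) 4)) := by
  refine ⟨?_, ?_⟩
  · rw [shiftedStern_append10_four, shiftedStern_append10_four]
    exact lucasBranch_lt J m
  rw [shiftedStern_append10_four]
  have hbase : BoundedBelow (lucasBranch (J + 1) m) (append10 (m + 1) 4 * 2 ^ (2 * J + 1)) := by
    refine BoundedBelow.append10 (m + 1) _ ?_ ?_
    · rw [show 4 * 2 ^ (2 * (m + 1) + (2 * J + 1)) = 2 ^ (2 * (J + 1 + m) + 3) by ring]
      apply boundedBelow_two_pow
      have h1 := fib_lt_lucasBranch_zero (J + 1 + m)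
      have h2 := lucasBranch_mono (J + 1) 0 m
      rw [zero_add] at h2
      exact_mod_cast (h1.trans_le h2).le
    · intro j hj
      have h := lucasBranch_mono (J + 1) j (m - j)
      rw [show j + (m - j) = m by omega, lucasBranch,
        show 2 * (J + 1 + (m - j)) + 2 = 2 * (m + 1 - j) + (2 * J + 1) + 1 by omega,
        show 2 * (J + 1 + (m - j)) + 1 = 2 * (m + 1 - j) + (2 * J + 1) by omega] at h
      exact_mod_cast h
  have := BoundedBelow.append10 (M := lucasBranch (J + 1) m) (v := 2 * append10 (m + 1) 4) J 0 ?_ ?_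
  · simpa using this
  · rwa [show 2 * append10 (m + 1) 4 * 2 ^ (2 * J + 0) = append10 (m + 1) 4 * 2 ^ (2 * J + 1) by ring]
  intro j hj
  have hx := stern_two_mul (append10 (m + 1) 4)
  have hy := stern_two_mul_add_one (append10 (m + 1) 4)
  rw [stern_append10_succ, stern_append10_succ_add_one] at hy
  rw [stern_append10_succ] at hx
  obtain ⟨hs3, hrs, -⟩ := lucas_ratio m
  have hr0 : (0 : ℝ) ≤ stern (append10 m 4) := Nat.cast_nonneg _
  have hs0 : (0 : ℝ) ≤ stern (append10 m 4 + 1) := Nat.cast_nonneg _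
  have h := even_branch_le (2 * append10 (m + 1) 4) (J - j) j (by omega)
  rw [show J - j + j = J by omega, hx, hy] at h
  rw [lucasBranch, show 2 * (J + 1) + 2 = 2 * J + 2 + 2 by ring,
    show 2 * (J + 1) + 1 = 2 * J + 1 + 2 by ring]
  rw [add_zero]
  push_cast at h ⊢
  rw [fib_add_two_cast (2 * J + 2), fib_add_two_cast (2 * J + 1), fib_add_two_cast (2 * J)]
  have h2 := (goldenRatio_mul_fib_le J).1
  have h3 := eight_fifths_lt_goldenRatio
  have hb0 : (0 : ℝ) ≤ fib (2 * J) := Nat.cast_nonneg _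
  have h5 : (8 / 5 * fib (2 * J) : ℝ) ≤ goldenRatio * fib (2 * J) :=
    mul_le_mul_of_nonneg_right h3.le hb0
  -- With r, s the Stern values at `append10 m 4` and its successor, what remains is 5F(2J)s ≤
  -- (7F(2J+1) + 4F(2J))r. Given s ≤ 3r, this needs F(2J+1) ≥ (11/7)F(2J), and 8/5 > 11/7.
  have e1 := mul_nonneg hr0 (show (0 : ℝ) ≤ fib (2 * J + 1) - 8 / 5 * fib (2 * J) by linarith)
  have e2 := mul_le_mul_of_nonneg_right hs3 hb0
  have e3 := mul_nonneg hr0 hb0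
  linarith

theorem boundedBelow_append10_zero {M : ℝ} (i k : ℕ)
    (h : ∀ j < i, (fibBranch (i - j + k) j : ℝ) ≤ M) :
    BoundedBelow M (append10 i 0 * 2 ^ (2 * k)) := by
  refine BoundedBelow.append10 i _ (by simp [BoundedBelow]) fun j hj => ?_
  have := h j hj
  rw [fibBranch, show 2 * (i - j + k) = 2 * (i - j) + 2 * k by ring] at this
  rw [(stern_append10_zero j).1, (stern_append10_zero j).2]
  push_cast at this
  linarith

theorem recordGap_fib (J i : ℕ) (hi : 1 ≤ i) (hJ : i ≤ J) :
    RecordGap (2 * append10 (J + 1) (2 * append10 i 0))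
      (2 * append10 J (2 * append10 (i + 1) 0)) := by
  refine ⟨?_, ?_⟩
  · rw [shiftedStern_two_mul_append10, shiftedStern_two_mul_append10]
    exact fibBranch_lt (show i < J + 1 by omega)
  rw [shiftedStern_two_mul_append10]
  have hbase : BoundedBelow (fibBranch (J + 1 + 1) i)
      (append10 (i + 1) 0 * 2 ^ (2 * (J + 1))) := by
    refine boundedBelow_append10_zero _ _ fun j hj => ?_
    have h := fibBranch_mono (p := J + 1 + 1) (j := j) (d := i - j) (by omega)
    rw [show J + 1 + 1 + (i - j) = i + 1 - j + (J + 1) by omega, show j + (i - j) = i by omega] at h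
    exact_mod_cast h
  have := BoundedBelow.append10 (M := fibBranch (J + 1 + 1) i) (v := 2 * append10 (i + 1) 0) J 1 ?_ ?_
  · rwa [show append10 J (2 * append10 (i + 1) 0) * 2 ^ 1 =
      2 * append10 J (2 * append10 (i + 1) 0) by ring] at this
  · rwa [show 2 * append10 (i + 1) 0 * 2 ^ (2 * J + 1) = append10 (i + 1) 0 * 2 ^ (2 * (J + 1)) by ring]
  intro j hj
  -- The distance is odd because of the final 0. The bound is the i = 1 value of the family, at most
  -- the current one since 1 ≤ i.
  have h := odd_branch_le (i + 1) (J - j - 1) j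
  rw [show J - j - 1 + 1 + j + (i + 1) = J + 1 + 1 + (i - 1) by omega,
    show 2 * (J - j - 1) + 4 = 2 * (J - j) + 1 + 1 by omega,
    show 2 * (J - j - 1) + 3 = 2 * (J - j) + 1 by omega] at h
  have h2 := fibBranch_mono (p := J + 1 + 1) (j := 1) (d := i - 1) (by omega)
  rw [show 1 + (i - 1) = i by omega] at h2
  exact h.trans (by exact_mod_cast h2)

/-- The hypotheses say that i is the balanced position, where `fibBranch` is largest for a fixed sum
of arguments; this is the source of ⌈n/2⌉. -/
theorem recordGap_last (J i : ℕ) (h1 : i ≤ J + 1) (h2 : J ≤ i) :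
    RecordGap (2 * append10 J (2 * append10 i 0)) (append10 (J + i + 1) 0) := by
  rw [RecordGap, shiftedStern_two_mul_append10, shiftedStern_append10_zero]
  constructor
  · have e1 := Nat.fib_add (2 * i) (2 * J + 2)
    have e2 : fib (2 * i) < fib (2 * i + 1) := by exact_mod_cast fib_two_mul_lt i
    have e3 : 0 < fib (2 * J + 1) := Nat.fib_pos.2 (by omega)
    rw [show 2 * (J + i + 1) + 1 = 2 * i + (2 * J + 2) + 1 by ring, e1, fibBranch,
      show 2 * (J + 1) + 1 = 2 * J + 1 + 2 by ring, show 2 * (J + 1) = 2 * J + 2 by ring,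
      Nat.fib_add_two (n := 2 * J + 1)]
    have := mul_lt_mul_of_pos_right e2 e3
    rw [show 2 * J + 1 + 1 = 2 * J + 2 by ring]
    linarith
  · have := boundedBelow_append10_zero (M := fibBranch (J + 1) i) (J + i + 1) 0 ?_
    · simpa using this
    intro j hj
    rw [add_zero]
    rcases le_total j i with hji | hji
    · have h := fibBranch_mono (p := J + 1) (j := j) (d := i - j) (by omega)
      rw [show J + 1 + (i - j) = J + i + 1 - j by omega, show j + (i - j) = i by omega] at h
      exact_mod_cast h
    · rcases hji.eq_or_lt with rfl | hji
      · rw [show J + i + 1 - i = J + 1 by omega]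
      -- Past the balanced position, symmetry of `fibBranch` reflects the branch back to the
      -- increasing range.
      have h := fibBranch_mono (p := J + 1) (j := J + i + 1 - j) (d := j - J - 1) (by omega)
      rw [show J + 1 + (j - J - 1) = j by omega,
        show J + i + 1 - j + (j - J - 1) = i by omega, fibBranch_comm] at h
      exact_mod_cast h

/-! ### Binary strings -/

theorem binaryString_append10 (j v : ℕ) :
    binaryString (append10 j v) = binaryString v ++ strPow [1, 0] j := by
  induction j with
  | zero => simp [append10, strPow]
  | succ j ih =>
    have h : Nat.digits 2 (4 * append10 j v + 2) = 0 :: 1 :: Nat.digits 2 (append10 j v) := by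
      rw [show 4 * append10 j v + 2 = 0 + 2 * (1 + 2 * append10 j v) by ring,
        Nat.digits_add 2 (by norm_num) _ _ (by norm_num) (by omega),
        Nat.digits_add 2 (by norm_num) _ _ (by norm_num) (by omega)]
    rw [binaryString, append10, h, List.reverse_cons, List.reverse_cons, ← binaryString, ih, strPow,
      strPow, List.replicate_succ', List.flatten_append]
    simp

theorem binaryString_two_mul {v : ℕ} (hv : v ≠ 0) :
    binaryString (2 * v) = binaryString v ++ [0] := by
  rw [binaryString, binaryString, ← List.reverse_cons]
  congr 1
  have := Nat.digits_add 2 (by norm_num) 0 v (by norm_num) (Or.inr hv)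
  rwa [zero_add] at this

theorem le_append10 (j v : ℕ) : v ≤ append10 j v := by
  induction j with
  | zero => exact le_rfl
  | succ j ih => rw [append10]; omega

/-! ### Assembling the chain at length 2n+2 -/

theorem recordGap_lucas_sub {n k : ℕ} (hk : k + 1 < n) :
    RecordGap (append10 (n - 1 - k) (2 * append10 k 4))
      (append10 (n - 1 - (k + 1)) (2 * append10 (k + 1) 4)) := by
  have := recordGap_lucas (n - 1 - (k + 1)) k
  rwa [show n - 1 - (k + 1) + 1 = n - 1 - k by omega] at this

theorem recordGap_fib_sub {n k : ℕ} (hk : 1 ≤ k) (hkn : k < (n + 1) / 2) :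
    RecordGap (2 * append10 (n - k) (2 * append10 k 0))
      (2 * append10 (n - (k + 1)) (2 * append10 (k + 1) 0)) := by
  have := recordGap_fib (n - (k + 1)) k hk (by omega)
  rwa [show n - (k + 1) + 1 = n - k by omega] at this

theorem recordGap_last_half {n : ℕ} (hn : 1 ≤ n) :
    RecordGap (2 * append10 (n - (n + 1) / 2) (2 * append10 ((n + 1) / 2) 0))
      (append10 (n + 1) 0) := by
  have := recordGap_last (n - (n + 1) / 2) ((n + 1) / 2) (by omega) (by omega)
  rwa [show n - (n + 1) / 2 + (n + 1) / 2 + 1 = n + 1 by omega] at this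

theorem recordGap_first_sub {n : ℕ} (hn : 1 ≤ n) :
    RecordGap (2 * append10 n 0) (append10 (n - 1 - 0) (2 * append10 0 4)) := by
  have := recordGap_first (n - 1)
  rwa [show n - 1 + 1 = n by omega] at this

theorem binaryString_length (v : ℕ) : (binaryString v).length = (Nat.digits 2 v).length :=
  List.length_reverse

theorem recordSetters_cases {n v : ℕ} (hn : 1 ≤ n) (hv : v ∈ recordSetters shiftedStern)
    (hlen : (binaryString v).length = 2 * n + 2) :
    (∃ m < n, v = append10 (n - 1 - m) (2 * append10 m 4)) ∨
      (∃ i, 1 < i ∧ i ≤ (n + 1) / 2 ∧ v = 2 * append10 (n - i) (2 * append10 i 0)) ∨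
      v = append10 (n + 1) 0 := by
  rw [binaryString_length] at hlen
  have hlt : v < 2 ^ (2 * n + 2) := (Nat.digits_length_le_iff (by norm_num) v).1 hlen.le
  have hge : 2 ^ (2 * n + 1) ≤ v :=
    (Nat.lt_digits_length_iff (by norm_num) v).1 (by omega)
  -- (10)^(n+1) attains F(2n+3), the maximum over all indices below 2^(2n+2), so no later index of
  -- this length sets a record.
  have hle : v ≤ append10 (n + 1) 0 := by
    by_contra! h
    have h1 := hv _ h
    rw [shiftedStern_append10_zero] at h1
    have h2 : shiftedStern v ≤ fib (2 * n + 2 + 1) := by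
      exact_mod_cast boundedBelow_two_pow (2 * n + 2) le_rfl v hlt
    rw [show 2 * (n + 1) + 1 = 2 * n + 2 + 1 by ring] at h1
    omega
  have hbig : ¬ v ≤ 2 * append10 n 0 := by
    have := append10_mul_lt n 0 1
    omega
  rcases hle.eq_or_lt with h | h
  · exact Or.inr (Or.inr h)
  rcases le_or_eq_of_recordGap (f := fun i => 2 * append10 (n - i) (2 * append10 i 0))
    (show 1 ≤ (n + 1) / 2 by omega) (fun k => recordGap_fib_sub) hv
    ((recordGap_last_half hn).le_of_lt hv h) with h | ⟨k, h1, h2, h3⟩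
  -- The families meet: 100(10)^(n-1)0 is (10)0(10)^(n-1)0. Hence i starts above 1 in the second
  -- one.
  · replace h : v ≤ append10 (n - 1 - (n - 1)) (2 * append10 (n - 1) 4) := by
      have e (j : ℕ) : append10 j 4 = append10 j (2 * append10 1 0) := rfl
      rwa [Nat.sub_self, append10, e]
    left
    rcases le_or_eq_of_recordGap (f := fun m => append10 (n - 1 - m) (2 * append10 m 4))
      (Nat.zero_le (n - 1)) (fun k _ hk => recordGap_lucas_sub (by omega)) hv h with
      h | ⟨k, -, h2, h3⟩
    · refine ⟨0, hn, ?_⟩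
      rcases h.eq_or_lt with h | h
      · exact h
      · exact absurd ((recordGap_first_sub hn).le_of_lt hv h) hbig
    · exact ⟨k, by omega, h3⟩
  · exact Or.inr (Or.inl ⟨k, h1, h2, h3⟩)

theorem append10_lucas_mem {n m : ℕ} (hm : m < n) :
    append10 (n - 1 - m) (2 * append10 m 4) ∈ recordSetters shiftedStern := by
  cases m with
  | zero => exact (recordGap_first_sub hm).mem_recordSetters
  | succ m => exact (recordGap_lucas_sub hm).mem_recordSetters

theorem append10_fib_mem {n i : ℕ} (h1 : 1 < i) (hi : i ≤ (n + 1) / 2) :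
    2 * append10 (n - i) (2 * append10 i 0) ∈ recordSetters shiftedStern := by
  obtain ⟨i, rfl⟩ := Nat.exists_eq_add_of_le' h1.le
  exact (recordGap_fib_sub (by omega) (by omega)).mem_recordSetters

theorem strPow_length (k : ℕ) : (strPow [1, 0] k).length = 2 * k := by
  simp [strPow, mul_comm]

theorem binaryString_lucas (J m : ℕ) : binaryString (append10 J (2 * append10 m 4)) =
    [1, 0, 0] ++ strPow [1, 0] m ++ [0] ++ strPow [1, 0] J := by
  have h4 : binaryString 4 = [1, 0, 0] := by simp [binaryString]
  have := le_append10 m 4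
  rw [binaryString_append10, binaryString_two_mul (by omega), binaryString_append10, h4]

theorem binaryString_append10_zero (j : ℕ) : binaryString (append10 j 0) = strPow [1, 0] j := by
  rw [binaryString_append10]
  simp [binaryString]

theorem binaryString_fib (J : ℕ) {i : ℕ} (hi : 1 ≤ i) :
    binaryString (2 * append10 J (2 * append10 i 0)) =
      strPow [1, 0] i ++ [0] ++ strPow [1, 0] J ++ [0] := by
  obtain ⟨i, rfl⟩ := Nat.exists_eq_add_of_le' hi
  have h : append10 (i + 1) 0 ≠ 0 := by rw [append10]; omega
  have h' := le_append10 J (2 * append10 (i + 1) 0)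
  rw [binaryString_two_mul (by omega), binaryString_append10, binaryString_two_mul h,
    binaryString_append10_zero]

theorem le_ceil_half_iff (n i : ℕ) : i ≤ ⌈(n : ℚ) / 2⌉₊ ↔ i ≤ (n + 1) / 2 := by
  cases i with
  | zero => simp
  | succ k =>
    rw [Nat.succ_le_iff, Nat.lt_ceil, lt_div_iff₀ (by norm_num)]
    have : (k : ℚ) * 2 < n ↔ k * 2 < n := by exact_mod_cast Iff.rfl
    rw [this]
    omega

end SternRecord

theorem mainTheorem2 (n : ℕ) (hn : 5 ≤ n) :
    {w : List ℕ | w.length = 2 * n + 2 ∧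
        ∃ v ∈ SternRecord.recordSetters SternRecord.shiftedStern,
          SternRecord.binaryString v = w} =
      {[1, 0, 0, 0] ++ SternRecord.strPow [1, 0] (n - 1)} ∪
      {w | ∃ i : ℕ, 0 ≤ i ∧ i ≤ n - 2 ∧
        w = [1, 0, 0] ++ SternRecord.strPow [1, 0] (i + 1) ++ [0] ++
          SternRecord.strPow [1, 0] (n - i - 2)} ∪
      {w | ∃ i : ℕ, 1 < i ∧ i ≤ ⌈(n : ℚ) / 2⌉₊ ∧
        w = SternRecord.strPow [1, 0] i ++ [0] ++
          SternRecord.strPow [1, 0] (n - i) ++ [0]} ∪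
      {SternRecord.strPow [1, 0] (n + 1)} := by
  open SternRecord in
  ext w
  simp only [Set.mem_ofPred_eq, Set.mem_union, Set.mem_singleton_iff, le_ceil_half_iff]
  constructor
  · rintro ⟨hlen, v, hv, rfl⟩
    rcases recordSetters_cases (by omega) hv hlen with ⟨m, hm, rfl⟩ | ⟨i, h1, hi, rfl⟩ | rfl
    · left; left
      rw [binaryString_lucas]
      cases m with
      | zero => left; simp [strPow]
      | succ i =>
        right
        refine ⟨i, Nat.zero_le _, by omega, ?_⟩
        rw [show n - 1 - (i + 1) = n - i - 2 by omega]
    · left; right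
      exact ⟨i, h1, hi, binaryString_fib _ h1.le⟩
    · right
      exact binaryString_append10_zero _
  · rintro (((rfl | ⟨i, -, hi, rfl⟩) | ⟨i, h1, hi, rfl⟩) | rfl)
    · refine ⟨by simp [strPow_length]; omega, _, append10_lucas_mem (show 0 < n by omega), ?_⟩
      rw [binaryString_lucas]
      simp [strPow]
    · refine ⟨by simp [strPow_length]; omega, _,
        append10_lucas_mem (show i + 1 < n by omega), ?_⟩
      rw [binaryString_lucas, show n - 1 - (i + 1) = n - i - 2 by omega]
    · refine ⟨by simp [strPow_length]; omega, _, append10_fib_mem h1 hi, ?_⟩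
      exact binaryString_fib _ h1.le
    · refine ⟨by rw [strPow_length]; ring, _,
        (recordGap_last_half (show 1 ≤ n by omega)).mem_recordSetters, ?_⟩
      exact binaryString_append10_zero _
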